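/- Let $M$ be a closed oriented Riemannian three-manifold with a fixed spin structure and spinor bundle $S$ (a Hermitian bundle with fibre $\mathbb C^2$ and structure group $\mathrm{SU}(2)=\mathrm{Spin}(3)$), and let $J$ be the quaternionic structure on $S$, i.e. the fibrewise complex-antilinear automorphism with $J^2=-\mathrm{id}$ induced by $J(z_1,z_2)=(-\bar z_2,\bar z_1)$ on $\mathbb C^2$. For a $\mathrm U(1)$-bundle $\mathscr L$ with a connection $A$, an $\mathrm{SU}(m)$-bundle $E$ with a connection $B$, a smooth section $\Psi$ of $\mathrm{Hom}(E,S\otimes\mathscr L)$ and $\tau\ge 0$, the Seiberg–Witten equation with $m$ spinors for $(A,\Psi,\tau)$ is $$\|\Psi\|_{L^2}=1,\qquad D_{A\otimes B}\Psi=0,\qquad \tau^2F_A=\mu(\Psi),$$ where $D_{A\otimes B}$ is the twisted Dirac operator, $\mu(\Psi)=\Psi\Psi^*-\tfrac12|\Psi|^2\,\mathrm{id}_S$, and $F_A$ acts on $S$ by Clifford multiplication. Let $\psi_1,\dots,\psi_n$ be smooth harmonic spinors on $M$ (sections of $S$ annihilated by the Dirac operator) and let $$\Psi=(\psi_1,J\psi_1,\dots,\psi_n,J\psi_n),$$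 regarded as a section of $\mathrm{Hom}(E,S\otimes\mathscr L)$ with $\mathscr L=\underline{\mathbb C}$ and $E=\underline{\mathbb C}^{2n}$, by $y\mapsto\sum_{l}(y_{2l-1}\psi_l+y_{2l}J\psi_l)$. Let $\vartheta$ and $B$ be the product connections on $\mathscr L$ and $E$. Then: 1. $D_{\vartheta\otimes B}\Psi=0$ and $\tau^2F_\vartheta=\mu(\Psi)$ with $\tau=0$, that is, $\mu(\Psi)=0$. 2. For every smooth spinor $\varphi$, harmonic or not, $\mu(\varphi,J\varphi)=0$ at every point of $M$. 3. $(\vartheta,\Psi,0)$ solves the full Seiberg–Witten equation with $2n$ spinors, including the normalisation $\|\Psi\|_{L^2}=1$, if and only if $\sum_{l=1}^n\|\psi_l\|_{L^2}^2=\tfrac12$. 4. If the $\psi_l$ are not all identically zero, there is exactly one constant $c>0$ such that $(\vartheta,c\,\Psi,0)$ solves the full Seiberg–Witten equation with $2n$ spinors. -/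

import Mathlib

open scoped Manifold ContDiff Matrix ENNReal
open MeasureTheory

noncomputable section

namespace MultiSW

/-! ### Three-manifolds, vector fields, metrics, orientations -/

/-- The model space of a three-manifold. -/
abbrev E3 : Type := EuclideanSpace ℝ (Fin 3)

/-- A vector field on `M` (no regularity). -/
abbrev VField (M : Type*) [TopologicalSpace M] [ChartedSpace E3 M] : Type _ :=
  (x : M) → TangentSpace (𝓡 3) x

/-- The vector field `X` is smooth on the set `U`. -/
def SmoothFieldOn {M : Type*} [TopologicalSpace M] [ChartedSpace E3 M] [IsManifold (𝓡 3) ∞ M]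
    (X : VField M) (U : Set M) : Prop :=
  ContMDiffOn (𝓡 3) ((𝓡 3).prod 𝓘(ℝ, E3)) ∞
    (fun x => (⟨x, X x⟩ : TangentBundle (𝓡 3) M)) U

/-- A smooth Riemannian metric on `M`. -/
abbrev RMetric (M : Type*) [TopologicalSpace M] [ChartedSpace E3 M] [IsManifold (𝓡 3) ∞ M] :
    Type _ :=
  Bundle.ContMDiffRiemannianMetric (𝓡 3) ∞ E3 (fun x : M => TangentSpace (𝓡 3) x)

/-- The vectors `v 0, v 1, v 2` form a basis of the tangent space which is positive
for the orientation `o`. -/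
def IsPositive {M : Type*} [TopologicalSpace M] [ChartedSpace E3 M] {x : M}
    (o : Orientation ℝ (TangentSpace (𝓡 3) x) (Fin 3)) (v : Fin 3 → TangentSpace (𝓡 3) x) : Prop :=
  ∃ b : Module.Basis (Fin 3) ℝ (TangentSpace (𝓡 3) x), (∀ k, b k = v k) ∧ b.orientation = o

/-- An orientation of `M`: an orientation of every tangent space, which near every point
is the one given by some smooth local frame. -/
structure MOrientation (M : Type*) [TopologicalSpace M] [ChartedSpace E3 M]
    [IsManifold (𝓡 3) ∞ M] where
  orient : (x : M) → Orientation ℝ (TangentSpace (𝓡 3) x) (Fin 3)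
  locally_const : ∀ x : M, ∃ U : Set M, IsOpen U ∧ x ∈ U ∧ ∃ e : Fin 3 → VField M,
    (∀ k, SmoothFieldOn (e k) U) ∧ ∀ y ∈ U, IsPositive (orient y) (fun k => e k y)

section Calculus

variable {M : Type*} [TopologicalSpace M] [ChartedSpace E3 M]

/-- The derivative of a real function along a tangent vector. -/
def derivR (f : M → ℝ) (x : M) (v : TangentSpace (𝓡 3) x) : ℝ :=
  mfderiv (𝓡 3) 𝓘(ℝ, ℝ) f x v

/-- The derivative of a complex function along a tangent vector. -/
def derivC (f : M → ℂ) (x : M) (v : TangentSpace (𝓡 3) x) : ℂ :=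
  mfderiv (𝓡 3) 𝓘(ℝ, ℂ) f x v

/-- The (entrywise) derivative of a vector-valued function. -/
def derivVec {p : ℕ} (f : M → Fin p → ℂ) (x : M) (v : TangentSpace (𝓡 3) x) : Fin p → ℂ :=
  fun a => derivC (fun y => f y a) x v

/-- The (entrywise) derivative of a matrix-valued function. -/
def derivMat {p q : ℕ} (f : M → Matrix (Fin p) (Fin q) ℂ) (x : M) (v : TangentSpace (𝓡 3) x) :
    Matrix (Fin p) (Fin q) ℂ :=
  Matrix.of fun a b => derivC (fun y => f y a b) x v

/-- Smoothness of a complex function on a set. -/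
def SmoothC (f : M → ℂ) (U : Set M) : Prop := ContMDiffOn (𝓡 3) 𝓘(ℝ, ℂ) ∞ f U

/-- Smoothness (of all entries) of a matrix-valued function on a set. -/
def SmoothMat {p q : ℕ} (f : M → Matrix (Fin p) (Fin q) ℂ) (U : Set M) : Prop :=
  ∀ a b, SmoothC (fun x => f x a b) U

/-- The Levi-Civita connection through the Koszul formula: this is `g(∇_X Y, Z)` at `x`. -/
def leviCivita [IsManifold (𝓡 3) ∞ M] (g : RMetric M) (X Y Z : VField M) (x : M) : ℝ :=
  (1 / 2) *
    (derivR (fun y => g.inner y (Y y) (Z y)) x (X x)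
      + derivR (fun y => g.inner y (X y) (Z y)) x (Y x)
      - derivR (fun y => g.inner y (X y) (Y y)) x (Z x)
      + g.inner x (VectorField.mlieBracket (𝓡 3) X Y x) (Z x)
      - g.inner x (VectorField.mlieBracket (𝓡 3) X Z x) (Y x)
      - g.inner x (VectorField.mlieBracket (𝓡 3) Y Z x) (X x))

end Calculus

/-! ### The Riemannian volume measure -/

section Volume

variable {M : Type*} [TopologicalSpace M] [ChartedSpace E3 M] [IsManifold (𝓡 3) ∞ M]

/-- The coordinate vector field `∂ᵢ` of the chart centred at `c`, at the point with
coordinates `u`. -/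
def coordVec (c : M) (u : E3) (i : Fin 3) :
    TangentSpace (𝓡 3) ((chartAt E3 c).symm u) :=
  mfderiv (𝓡 3) (𝓡 3) (chartAt E3 c).symm u (EuclideanSpace.single i (1 : ℝ))

/-- The density `√det g(∂ᵢ, ∂ⱼ)` of the Riemannian volume in the chart centred at `c`. -/
def volDensity (g : RMetric M) (c : M) (u : E3) : ℝ :=
  Real.sqrt (Matrix.det (Matrix.of fun i j : Fin 3 =>
    g.inner ((chartAt E3 c).symm u) (coordVec c u i) (coordVec c u j)))

/-- The Riemannian volume of the domain of the chart centred at `c`, as a measure on `M`. -/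
def chartVolume [MeasurableSpace M] (g : RMetric M) (c : M) : Measure M :=
  Measure.map (chartAt E3 c).symm
    ((volume.restrict (chartAt E3 c).target).withDensity
      fun u => ENNReal.ofReal (volDensity g c u))

/-- A smooth partition of unity subordinate to the domains of the charts. -/
def chartPartition (M : Type*) [TopologicalSpace M] [ChartedSpace E3 M] [IsManifold (𝓡 3) ∞ M]
    [T2Space M] [SigmaCompactSpace M] : SmoothPartitionOfUnity M (𝓡 3) M Set.univ :=
  (SmoothPartitionOfUnity.exists_isSubordinate_chartAt_source (𝓡 3) M).choose

/-- The Riemannian volume measure, `∫ f dvol = ∑ᵢ ∫ ρᵢ f √det g du` for a partition of unity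
`ρ` subordinate to the charts. -/
def riemVolume [T2Space M] [SigmaCompactSpace M] [MeasurableSpace M] (g : RMetric M) :
    Measure M :=
  Measure.sum fun c : M =>
    (chartVolume g c).withDensity fun x => ENNReal.ofReal (chartPartition M c x)

end Volume

/-! ### Bundles with a matrix structure group and their connections -/

/-- A smooth `G`-bundle over `M`, `G` a group of `r × r` matrices, presented by local
trivialisations: an open cover and smooth transition functions which satisfy the cocycle condition.
A section of the associated bundle with fibre `ℂʳ` is a family `sᵢ : U i → ℂʳ` with
`sᵢ = trans i j * sⱼ`. The index `indexAt x` is a chosen trivialisation near `x`. -/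
structure GBundle.{u, w} (M : Type u) [TopologicalSpace M] [ChartedSpace E3 M] (r : ℕ)
    (G : Submonoid (Matrix (Fin r) (Fin r) ℂ)) where
  ι : Type w
  U : ι → Set M
  isOpen_U : ∀ i, IsOpen (U i)
  indexAt : M → ι
  mem_U_at : ∀ x, x ∈ U (indexAt x)
  trans : ι → ι → M → Matrix (Fin r) (Fin r) ℂ
  trans_mem : ∀ i j, ∀ x ∈ U i ∩ U j, trans i j x ∈ G
  trans_smooth : ∀ i j, SmoothMat (trans i j) (U i ∩ U j)
  trans_self : ∀ i, ∀ x ∈ U i, trans i i x = 1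
  trans_comp : ∀ i j k, ∀ x ∈ U i ∩ U j ∩ U k, trans i j x * trans j k x = trans i k x

/-- The Lie algebra `u(r)` of skew-Hermitian matrices. -/
def uLie (r : ℕ) : Submodule ℝ (Matrix (Fin r) (Fin r) ℂ) where
  carrier := {X | Xᴴ = -X}
  add_mem' {X Y} hX hY := by
    simp only [Set.mem_ofPred_eq] at *
    rw [Matrix.conjTranspose_add, hX, hY, neg_add]
  zero_mem' := by simp
  smul_mem' c X hX := by
    simp only [Set.mem_ofPred_eq] at *
    rw [Matrix.conjTranspose_smul, hX, star_trivial, smul_neg]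

/-- The Lie algebra `su(r)` of trace-free skew-Hermitian matrices. -/
def suLie (r : ℕ) : Submodule ℝ (Matrix (Fin r) (Fin r) ℂ) where
  carrier := {X | X ∈ uLie r ∧ X.trace = 0}
  add_mem' {X Y} hX hY := ⟨add_mem hX.1 hY.1, by rw [Matrix.trace_add, hX.2, hY.2, add_zero]⟩
  zero_mem' := ⟨zero_mem _, by simp⟩
  smul_mem' c X hX := ⟨Submodule.smul_mem _ c hX.1, by rw [Matrix.trace_smul, hX.2, smul_zero]⟩

/-- A connection on a `G`-bundle, `G` with Lie algebra `𝔤`: local `𝔤`-valued one-forms, smooth, and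
related by `Aⱼ = g⁻¹ Aᵢ g + g⁻¹ dg` for the transition function `g = trans i j`. The covariant
derivative of a section is `d sᵢ + Aᵢ sᵢ`. -/
structure Connection {M : Type*} [TopologicalSpace M] [ChartedSpace E3 M]
    [IsManifold (𝓡 3) ∞ M] {r : ℕ} {G : Submonoid (Matrix (Fin r) (Fin r) ℂ)}
    (P : GBundle M r G) (𝔤 : Submodule ℝ (Matrix (Fin r) (Fin r) ℂ)) where
  form : P.ι → (x : M) → TangentSpace (𝓡 3) x →ₗ[ℝ] Matrix (Fin r) (Fin r) ℂ
  form_mem : ∀ i, ∀ x ∈ P.U i, ∀ v, form i x v ∈ 𝔤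
  form_smooth : ∀ i, ∀ V : Set M, IsOpen V → V ⊆ P.U i → ∀ X : VField M, SmoothFieldOn X V →
    SmoothMat (fun x => form i x (X x)) V
  form_trans : ∀ i j, ∀ x ∈ P.U i ∩ P.U j, ∀ v,
    P.trans i j x * form j x v = form i x v * P.trans i j x + derivMat (P.trans i j) x v

/-- The product bundle, with a single global trivialisation. -/
def GBundle.product (M : Type*) [TopologicalSpace M] [ChartedSpace E3 M] (r : ℕ)
    (G : Submonoid (Matrix (Fin r) (Fin r) ℂ)) : GBundle.{_, 0} M r G where
  ι := Unit
  U := fun _ => Set.univ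
  isOpen_U := fun _ => isOpen_univ
  indexAt := fun _ => ()
  mem_U_at := fun _ => Set.mem_univ _
  trans := fun _ _ _ => 1
  trans_mem := fun _ _ _ _ => one_mem G
  trans_smooth := fun _ _ _ _ => contMDiffOn_const
  trans_self := fun _ _ _ => rfl
  trans_comp := fun _ _ _ _ _ => one_mul 1

/-- The product connection on the product bundle. -/
def Connection.product (M : Type*) [TopologicalSpace M] [ChartedSpace E3 M]
    [IsManifold (𝓡 3) ∞ M] (r : ℕ) (G : Submonoid (Matrix (Fin r) (Fin r) ℂ))
    (𝔤 : Submodule ℝ (Matrix (Fin r) (Fin r) ℂ)) : Connection (GBundle.product M r G) 𝔤 where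
  form := fun _ _ => 0
  form_mem := fun _ _ _ _ => zero_mem 𝔤
  form_smooth := fun _ _ _ _ _ _ _ _ => contMDiffOn_const
  form_trans := by
    intro i j x _ v
    ext a b
    have h : derivC (fun _ : M => (1 : Matrix (Fin r) (Fin r) ℂ) a b) x v = 0 := by
      unfold derivC
      rw [mfderiv_const]
      rfl
    simpa [derivMat, GBundle.product] using h.symm

/-- A `U(1)`-bundle. -/
abbrev U1Bundle.{u, w} (M : Type u) [TopologicalSpace M] [ChartedSpace E3 M] : Type _ :=
  GBundle.{u, w} M 1 (Matrix.unitaryGroup (Fin 1) ℂ)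

/-- An `SU(m)`-bundle. -/
abbrev SUBundle.{u, w} (M : Type u) [TopologicalSpace M] [ChartedSpace E3 M] (m : ℕ) : Type _ :=
  GBundle.{u, w} M m (Matrix.specialUnitaryGroup (Fin m) ℂ)

/-- The curvature `F_A(X, Y) = X A(Y) - Y A(X) - A([X, Y])` of a connection on a `U(1)`-bundle, in
the local trivialisation `j`. -/
def curvature {M : Type*} [TopologicalSpace M] [ChartedSpace E3 M] [IsManifold (𝓡 3) ∞ M]
    {L : U1Bundle M} (A : Connection L (uLie 1)) (j : L.ι) (X Y : VField M) (x : M) : ℂ :=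
  derivC (fun y => A.form j y (Y y) 0 0) x (X x) - derivC (fun y => A.form j y (X y) 0 0) x (Y x)
    - A.form j x (VectorField.mlieBracket (𝓡 3) X Y x) 0 0

/-! ### Linear algebra of spinors in dimension three -/

/-- The Pauli matrices. -/
def pauli : Fin 3 → Matrix (Fin 2) (Fin 2) ℂ :=
  ![!![0, 1; 1, 0], !![0, -Complex.I; Complex.I, 0], !![1, 0; 0, -1]]

/-- Clifford multiplication by the vectors of the standard basis of `ℝ³` on `ℂ²`, `γₖ² = -1`. -/
def gam (k : Fin 3) : Matrix (Fin 2) (Fin 2) ℂ := (-Complex.I) • pauli k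

/-- The double covering `Spin(3) = SU(2) → SO(3)`: the matrix `R` with
`h σₗ h⁻¹ = ∑ₖ Rₖₗ σₖ`. -/
def spinCover (h : Matrix (Fin 2) (Fin 2) ℂ) : Matrix (Fin 3) (Fin 3) ℝ :=
  Matrix.of fun k l => (1 / 2) * (Matrix.trace (pauli k * h * pauli l * hᴴ)).re

/-- The quaternionic structure of the spin representation `ℂ²`. -/
def quatJ (v : Fin 2 → ℂ) : Fin 2 → ℂ := ![-star (v 1), star (v 0)]

/-- The quadratic map `μ(B) = B B* - ½ |B|²` on `Hom(ℂᵐ, ℂ²)`. -/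
def mu {m : ℕ} (B : Matrix (Fin 2) (Fin m) ℂ) : Matrix (Fin 2) (Fin 2) ℂ :=
  B * Bᴴ - (((1 / 2 : ℝ) * ∑ a, ∑ b, ‖B a b‖ ^ 2 : ℝ) : ℂ) • (1 : Matrix (Fin 2) (Fin 2) ℂ)

/-! ### Spin structures and spinors -/

section Spin

variable {M : Type*} [TopologicalSpace M] [ChartedSpace E3 M] [IsManifold (𝓡 3) ∞ M]

/-- A spin structure on the oriented Riemannian three-manifold `(M, g, o)`, through local
trivialisations: a `Spin(3) = SU(2)`-bundle whose transition functions lift, through the double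
covering `SU(2) → SO(3)`, the transition functions of positive orthonormal local frames of `TM`. -/
structure SpinStructure (g : RMetric M) (o : MOrientation M) extends
    GBundle M 2 (Matrix.specialUnitaryGroup (Fin 2) ℂ) where
  frame : ι → Fin 3 → VField M
  frame_smooth : ∀ i k, SmoothFieldOn (frame i k) (U i)
  frame_orthonormal : ∀ i, ∀ x ∈ U i, ∀ k l,
    g.inner x (frame i k x) (frame i l x) = if k = l then 1 else 0
  frame_positive : ∀ i, ∀ x ∈ U i, IsPositive (o.orient x) (fun k => frame i k x)
  frame_lift : ∀ i j, ∀ x ∈ U i ∩ U j, ∀ k l,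
    spinCover (trans i j x) k l = g.inner x (frame i k x) (frame j l x)

variable {g : RMetric M} {o : MOrientation M}

/-- The spin connection in the local frame `e = S.frame i`, evaluated on `eₖ`:
`¼ ∑ₐᵦ g(∇_{eₖ} eₐ, eᵦ) γₐ γᵦ`. -/
def SpinStructure.conn (S : SpinStructure g o) (i : S.ι) (k : Fin 3) (x : M) :
    Matrix (Fin 2) (Fin 2) ℂ :=
  ∑ a, ∑ b, (((1 / 4) * leviCivita g (S.frame i k) (S.frame i a) (S.frame i b) x : ℝ) : ℂ) •
    (gam a * gam b)

/-- A smooth spinor: a smooth section of the spinor bundle. -/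
structure Spinor (S : SpinStructure g o) where
  rep : S.ι → M → Fin 2 → ℂ
  smooth : ∀ i a, SmoothC (fun x => rep i x a) (S.U i)
  compat : ∀ i j, ∀ x ∈ S.U i ∩ S.U j, rep i x = S.trans i j x *ᵥ rep j x

/-- The Dirac operator `∑ₖ γₖ ∇_{eₖ} ψ`, in the local frame `i`. -/
def Spinor.dirac {S : SpinStructure g o} (ψ : Spinor S) (i : S.ι) (x : M) : Fin 2 → ℂ :=
  ∑ k, gam k *ᵥ (derivVec (ψ.rep i) x (S.frame i k x) + S.conn i k x *ᵥ ψ.rep i x)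

/-- A spinor is harmonic if the Dirac operator annihilates it. -/
def Spinor.IsHarmonic {S : SpinStructure g o} (ψ : Spinor S) : Prop :=
  ∀ i, ∀ x ∈ S.U i, ψ.dirac i x = 0

/-- The pointwise squared norm of a spinor. -/
def Spinor.normSq {S : SpinStructure g o} (ψ : Spinor S) (x : M) : ℝ :=
  ∑ a, ‖ψ.rep (S.indexAt x) x a‖ ^ 2

/-- The `L²`-norm of a spinor. -/
def Spinor.l2norm [T2Space M] [SigmaCompactSpace M] [MeasurableSpace M] {S : SpinStructure g o}
    (ψ : Spinor S) : ℝ≥0∞ :=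
  (∫⁻ x, ENNReal.ofReal (ψ.normSq x) ∂(riemVolume g)) ^ (1 / 2 : ℝ)

/-- The quaternionic structure commutes with the action of `SU(2)`. -/
theorem quatJ_mulVec {h : Matrix (Fin 2) (Fin 2) ℂ}
    (hh : h ∈ Matrix.specialUnitaryGroup (Fin 2) ℂ) (v : Fin 2 → ℂ) :
    quatJ (h *ᵥ v) = h *ᵥ quatJ v := by
  rw [Matrix.mem_specialUnitaryGroup_iff] at hh
  obtain ⟨hu, hd⟩ := hh
  have h1 : star h * h = 1 := (Matrix.mem_unitaryGroup_iff').1 hu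
  have h2 : star h = h.adjugate := by
    have h3 : h * h.adjugate = 1 := by rw [Matrix.mul_adjugate, hd, one_smul]
    calc star h = star h * (h * h.adjugate) := by rw [h3, mul_one]
      _ = h.adjugate := by rw [← mul_assoc, h1, one_mul]
  rw [Matrix.adjugate_fin_two] at h2
  have e00 := congrFun (congrFun h2 0) 0
  have e01 := congrFun (congrFun h2 0) 1
  have e10 := congrFun (congrFun h2 1) 0
  have e11 := congrFun (congrFun h2 1) 1
  simp [Matrix.star_apply] at e00 e01 e10 e11
  ext a
  fin_cases a
  · simp [quatJ, Matrix.mulVec, dotProduct, Fin.sum_univ_two, e00, e01, e10, e11]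
  · simp [quatJ, Matrix.mulVec, dotProduct, Fin.sum_univ_two, e00, e01, e10, e11]
    ring

/-- The quaternionic structure `J` of the spinor bundle, acting on spinors. -/
def Spinor.J {S : SpinStructure g o} (ψ : Spinor S) : Spinor S where
  rep := fun i x => quatJ (ψ.rep i x)
  smooth := by
    have key : ∀ (f : M → ℂ) (U : Set M), SmoothC f U → SmoothC (fun x => star (f x)) U :=
      fun f U hf =>
        (Complex.conjCLE.toContinuousLinearMap.contDiff.contMDiff (n := ∞)).comp_contMDiffOn hf
    intro i a
    fin_cases a
    · exact (contDiff_neg.contMDiff (n := ∞)).comp_contMDiffOn (key _ _ (ψ.smooth i 1))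
    · exact key _ _ (ψ.smooth i 0)
  compat := fun i j x hx => by
    rw [ψ.compat i j x hx]
    exact quatJ_mulVec (S.trans_mem i j x hx) _

end Spin

/-! ### Twisted spinors and the Seiberg–Witten equation with several spinors -/

section Twisted

variable {M : Type*} [TopologicalSpace M] [ChartedSpace E3 M] [IsManifold (𝓡 3) ∞ M]
  {g : RMetric M} {o : MOrientation M}

/-- A smooth section of `Hom(E, S ⊗ L)`; in local trivialisations of the three bundles it is a
`2 × m` matrix. -/
structure Twisted (S : SpinStructure g o) (L : U1Bundle M) {m : ℕ} (E : SUBundle M m) where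
  rep : S.ι → L.ι → E.ι → M → Matrix (Fin 2) (Fin m) ℂ
  smooth : ∀ i j k, SmoothMat (rep i j k) (S.U i ∩ L.U j ∩ E.U k)
  compat : ∀ i j k i' j' k', ∀ x ∈ S.U i ∩ L.U j ∩ E.U k ∩ (S.U i' ∩ L.U j' ∩ E.U k'),
    rep i j k x =
      L.trans j j' x 0 0 • (S.trans i i' x * rep i' j' k' x * (E.trans k k' x)ᴴ)

variable {S : SpinStructure g o} {L : U1Bundle M} {m : ℕ} {E : SUBundle M m}

/-- Multiplication of a twisted spinor by a real constant. -/
def Twisted.smul (c : ℝ) (Ψ : Twisted S L E) : Twisted S L E where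
  rep := fun i j k x => (c : ℂ) • Ψ.rep i j k x
  smooth := fun i j k a b =>
    ((c • ContinuousLinearMap.id ℝ ℂ).contDiff.contMDiff (n := ∞)).comp_contMDiffOn
      (Ψ.smooth i j k a b) |>.congr fun _ _ => by simp
  compat := fun i j k i' j' k' x hx => by
    rw [Ψ.compat i j k i' j' k' x hx, Matrix.mul_smul, Matrix.smul_mul, smul_comm]

/-- The covariant derivative of `Ψ` along the vector `e_l` of the local frame, for the connection
induced by the spin connection, by `A` and by `B`, in local trivialisations:
`dΨ + (Γ + A) Ψ - Ψ B`. -/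
def Twisted.nabla (A : Connection L (uLie 1)) (B : Connection E (suLie m)) (Ψ : Twisted S L E)
    (i : S.ι) (j : L.ι) (k : E.ι) (l : Fin 3) (x : M) : Matrix (Fin 2) (Fin m) ℂ :=
  derivMat (Ψ.rep i j k) x (S.frame i l x) + S.conn i l x * Ψ.rep i j k x
    + A.form j x (S.frame i l x) 0 0 • Ψ.rep i j k x
    - Ψ.rep i j k x * B.form k x (S.frame i l x)

/-- The twisted Dirac operator, in local trivialisations. -/
def Twisted.dirac (A : Connection L (uLie 1)) (B : Connection E (suLie m)) (Ψ : Twisted S L E)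
    (i : S.ι) (j : L.ι) (k : E.ι) (x : M) : Matrix (Fin 2) (Fin m) ℂ :=
  ∑ l, gam l * Ψ.nabla A B i j k l x

/-- The Dirac equation `D_{A ⊗ B} Ψ = 0`. -/
def Twisted.DiracEq (A : Connection L (uLie 1)) (B : Connection E (suLie m))
    (Ψ : Twisted S L E) : Prop :=
  ∀ i j k, ∀ x ∈ S.U i ∩ L.U j ∩ E.U k, Ψ.dirac A B i j k x = 0

/-- The curvature `F_A`, acting on spinors by Clifford multiplication,
`½ ∑ₐᵦ F_A(eₐ, eᵦ) γₐ γᵦ`; a trace-free Hermitian endomorphism of the spinor bundle. -/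
def cliffordCurvature (S : SpinStructure g o) (A : Connection L (uLie 1)) (i : S.ι) (j : L.ι)
    (x : M) : Matrix (Fin 2) (Fin 2) ℂ :=
  ∑ a, ∑ b, ((1 / 2 : ℂ) * curvature A j (S.frame i a) (S.frame i b) x) • (gam a * gam b)

/-- The curvature equation `τ² F_A = μ(Ψ)`. -/
def Twisted.CurvatureEq (A : Connection L (uLie 1)) (Ψ : Twisted S L E) (τ : ℝ) : Prop :=
  ∀ i j k, ∀ x ∈ S.U i ∩ L.U j ∩ E.U k,
    ((τ ^ 2 : ℝ) : ℂ) • cliffordCurvature S A i j x = mu (Ψ.rep i j k x)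

/-- The pointwise squared norm `|Ψ|²`. -/
def Twisted.normSq (Ψ : Twisted S L E) (x : M) : ℝ :=
  ∑ a, ∑ b, ‖Ψ.rep (S.indexAt x) (L.indexAt x) (E.indexAt x) x a b‖ ^ 2

/-- The `L²`-norm of a twisted spinor. -/
def Twisted.l2norm [T2Space M] [SigmaCompactSpace M] [MeasurableSpace M] (Ψ : Twisted S L E) :
    ℝ≥0∞ :=
  (∫⁻ x, ENNReal.ofReal (Ψ.normSq x) ∂(riemVolume g)) ^ (1 / 2 : ℝ)

/-- `(Ψ, A, τ)` solves the Seiberg–Witten equation with `m` spinors (background connection `B`). -/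
structure IsSWSolution [T2Space M] [SigmaCompactSpace M] [MeasurableSpace M]
    (B : Connection E (suLie m)) (Ψ : Twisted S L E) (A : Connection L (uLie 1)) (τ : ℝ) :
    Prop where
  norm_eq : Ψ.l2norm = 1
  dirac_eq : Ψ.DiracEq A B
  curvature_eq : Ψ.CurvatureEq A τ

/-- The product bundle `ℂ` as a `U(1)`-bundle. -/
abbrev trivL (M : Type*) [TopologicalSpace M] [ChartedSpace E3 M] : U1Bundle.{_, 0} M :=
  GBundle.product M 1 _

/-- The product bundle `ℂᵐ` as an `SU(m)`-bundle. -/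
abbrev trivE (M : Type*) [TopologicalSpace M] [ChartedSpace E3 M] (m : ℕ) : SUBundle.{_, 0} M m :=
  GBundle.product M m _

/-- The product connection on the product line bundle. -/
abbrev prodA (M : Type*) [TopologicalSpace M] [ChartedSpace E3 M] [IsManifold (𝓡 3) ∞ M] :
    Connection (trivL M) (uLie 1) :=
  Connection.product M 1 _ _

/-- The product connection on the product bundle `ℂᵐ`. -/
abbrev prodB (M : Type*) [TopologicalSpace M] [ChartedSpace E3 M] [IsManifold (𝓡 3) ∞ M]
    (m : ℕ) : Connection (trivE M m) (suLie m) :=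
  Connection.product M m _ _

/-- An `m`-tuple of spinors as a section of `Hom(ℂᵐ, S ⊗ ℂ)`, namely
`y ↦ ∑ₖ yₖ χₖ`: the `k`-th column of the matrix is `χₖ`. -/
def Twisted.ofTuple {m : ℕ} (χ : Fin m → Spinor S) : Twisted S (trivL M) (trivE M m) where
  rep := fun i _ _ x => Matrix.of fun a k => (χ k).rep i x a
  smooth := fun i _ _ a k => ((χ k).smooth i a).mono fun _ hx => hx.1.1
  compat := by
    intro i j k i' j' k' x hx
    have key : (Matrix.of fun a k => (χ k).rep i x a : Matrix (Fin 2) (Fin m) ℂ) =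
        (1 : Matrix (Fin 1) (Fin 1) ℂ) 0 0 •
          (S.trans i i' x * (Matrix.of fun a k => (χ k).rep i' x a : Matrix (Fin 2) (Fin m) ℂ) *
            (1 : Matrix (Fin m) (Fin m) ℂ)ᴴ) := by
      rw [Matrix.conjTranspose_one, Matrix.mul_one, Matrix.one_apply_eq, one_smul]
      ext a b
      exact congrFun ((χ b).compat i i' x ⟨hx.1.1.1, hx.2.1.1⟩) a
    exact key

/-- The tuple `(ψ₁, Jψ₁, …, ψₙ, Jψₙ)`. -/
def withJ {n : ℕ} (ψ : Fin n → Spinor S) (k : Fin (2 * n)) : Spinor S :=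
  if (k : ℕ) % 2 = 0 then ψ ⟨k / 2, by omega⟩ else (ψ ⟨k / 2, by omega⟩).J

end Twisted

end MultiSW

end

namespace MultiSW

/-! ### The quaternionic structure and the quadratic map -/

/-! The operator `J` is antilinear, but it commutes with all the data of the Dirac operator. The
matrices `gam k` are the unit quaternions `-iσₖ`, which commute with `J`; the spin connection is a
combination of products `gam a * gam b` with real coefficients; and differentiation commutes with
real-linear maps. Hence `J` preserves harmonic spinors (`Spinor.dirac_J`). For the product
connections the twisted Dirac operator acts on each column separately, which gives the Dirac
equation.

The map `μ` is additive over columns (`mu_eq_sum`). Since `v` and `Jv` are orthogonal of equal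
length, `v v* + (Jv)(Jv)* = |v|² id`, so each pair `(v, Jv)` contributes zero to `μ`, harmonic or
not.

Only the normalisation is left. As `J` is an isometry, the integral of `|Ψ|²` equals `2 ∑ ‖ψₗ‖²`,
and the condition is that this be `1`. Rescaling by `c` multiplies it by `c²`, so a unique positive
`c` exists as soon as the integral is neither `0` nor `∞`. It is finite because `M` is compact and
so of finite volume (`isFiniteMeasure_riemVolume`), and nonzero because a continuous nonnegative
function that is positive somewhere has positive integral (`lintegral_riemVolume_ne_zero`). -/

theorem quatJ_add (v w : Fin 2 → ℂ) : quatJ (v + w) = quatJ v + quatJ w := by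
  ext a
  fin_cases a <;> simp [quatJ, add_comm]

theorem quatJ_zero : quatJ 0 = 0 := by
  ext a
  fin_cases a <;> simp [quatJ]

theorem quatJ_sum {ι : Type*} (s : Finset ι) (v : ι → Fin 2 → ℂ) :
    quatJ (∑ k ∈ s, v k) = ∑ k ∈ s, quatJ (v k) := by
  classical
  induction s using Finset.induction_on with
  | empty => simp [quatJ_zero]
  | insert a s ha ih => rw [Finset.sum_insert ha, Finset.sum_insert ha, quatJ_add, ih]

theorem quatJ_real_smul (c : ℝ) (v : Fin 2 → ℂ) : quatJ ((c : ℂ) • v) = (c : ℂ) • quatJ v := by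
  ext a
  fin_cases a <;> simp [quatJ]

/-- The Pauli matrices anticommute with `J`, and so does the factor `-i`; the two signs cancel. -/
theorem quatJ_gam_mulVec (k : Fin 3) (v : Fin 2 → ℂ) : quatJ (gam k *ᵥ v) = gam k *ᵥ quatJ v := by
  ext a
  fin_cases k <;> fin_cases a <;>
    simp [quatJ, gam, pauli, Matrix.mulVec, dotProduct, Fin.sum_univ_two]

theorem mu_smul {m : ℕ} (c : ℝ) (B : Matrix (Fin 2) (Fin m) ℂ) :
    mu ((c : ℂ) • B) = ((c ^ 2 : ℝ) : ℂ) • mu B := by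
  have h : ∑ a, ∑ b, ‖((c : ℂ) • B) a b‖ ^ 2 = c ^ 2 * ∑ a, ∑ b, ‖B a b‖ ^ 2 := by
    simp only [Finset.mul_sum, Matrix.smul_apply, smul_eq_mul, norm_mul, mul_pow,
      Complex.norm_real, Real.norm_eq_abs, sq_abs]
  rw [mu, mu, h, Matrix.conjTranspose_smul, Matrix.smul_mul, Matrix.mul_smul, smul_smul, smul_sub,
    smul_smul]
  congr 2
  · simp [sq]
  · push_cast
    ring

/-- `μ` is the sum of its values on the columns. -/
theorem mu_eq_sum {m : ℕ} (B : Matrix (Fin 2) (Fin m) ℂ) :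
    mu B = ∑ k, mu (Matrix.of fun a (_ : Fin 1) => B a k) := by
  ext a b
  simp only [mu, Matrix.sub_apply, Matrix.smul_apply, Matrix.sum_apply, Matrix.mul_apply,
    Matrix.conjTranspose_apply, Matrix.of_apply, Finset.sum_sub_distrib,
    Fin.sum_univ_two, smul_eq_mul, ← Finset.sum_mul, ← Finset.mul_sum, ← Finset.sum_add_distrib,
    Complex.ofReal_mul, Complex.ofReal_sum, Finset.univ_unique, Finset.sum_singleton]

/-- For `v ≠ 0`, the vectors `v` and `Jv` form an orthogonal basis of `ℂ²` with equal lengths, so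
their rank-one projectors add up to `|v|² id`, exactly the trace part that `μ` removes. -/
theorem mu_col_add_mu_col_quatJ (v : Fin 2 → ℂ) :
    mu (Matrix.of fun a (_ : Fin 1) => v a) + mu (Matrix.of fun a (_ : Fin 1) => quatJ v a) =
      0 := by
  have key : ∀ z : ℂ, ((‖z‖ : ℂ)) ^ 2 = z * (starRingEnd ℂ) z := fun z => by
    rw [Complex.mul_conj, Complex.normSq_eq_norm_sq]; push_cast; rfl
  ext a b
  fin_cases a <;> fin_cases b <;>
    simp [mu, quatJ, Matrix.mul_apply, key] <;> ring

theorem sum_fin_two_mul {A : Type*} [AddCommMonoid A] {n : ℕ} (f : ℕ → A) :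
    ∑ k : Fin (2 * n), f k = ∑ l : Fin n, (f (2 * l) + f (2 * l + 1)) := by
  rw [Fin.sum_univ_eq_sum_range, Fin.sum_univ_eq_sum_range (fun l => f (2 * l) + f (2 * l + 1))]
  induction n with
  | zero => simp
  | succ n ih => rw [Nat.mul_succ, Finset.sum_range_succ, Finset.sum_range_succ,
      Finset.sum_range_succ, ih, add_assoc]

theorem rpow_half_sq (a : ℝ≥0∞) : (a ^ (1 / 2 : ℝ)) ^ 2 = a := by
  rw [← ENNReal.rpow_natCast, ← ENNReal.rpow_mul]
  norm_num

/-- For `0 < I < ∞` this is the real equation `c² I = 1`, whose only positive root is `1 / √I`. -/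
theorem existsUnique_pos_sq_mul_eq_one {I : ℝ≥0∞} (h0 : I ≠ 0) (ht : I ≠ ⊤) :
    ∃! c : ℝ, 0 < c ∧ ENNReal.ofReal (c ^ 2) * I = 1 := by
  have hI : 0 < I.toReal := ENNReal.toReal_pos h0 ht
  have key : ∀ c : ℝ, ENNReal.ofReal (c ^ 2) * I = 1 ↔ c ^ 2 * I.toReal = 1 := by
    intro c
    conv_lhs => rw [← ENNReal.ofReal_toReal (a := I) ht, ← ENNReal.ofReal_mul (sq_nonneg c)]
    exact ENNReal.ofReal_eq_one
  simp only [key]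
  refine ⟨(Real.sqrt I.toReal)⁻¹, ⟨by positivity, ?_⟩, ?_⟩
  · rw [inv_pow, Real.sq_sqrt hI.le, inv_mul_cancel₀ hI.ne']
  · rintro c ⟨hc, h⟩
    rw [← Real.sqrt_inv, eq_inv_of_mul_eq_one_left h |>.symm, Real.sqrt_sq hc.le]

/-! ### Derivatives and real-linear maps -/

section

variable {M : Type*} [TopologicalSpace M] [ChartedSpace E3 M]

theorem SmoothC.hasMFDerivAt {f : M → ℂ} {U : Set M} (hf : SmoothC f U) (hU : IsOpen U) {x : M}
    (hx : x ∈ U) : HasMFDerivAt (𝓡 3) 𝓘(ℝ, ℂ) f x (mfderiv (𝓡 3) 𝓘(ℝ, ℂ) f x) :=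
  (((hf x hx).contMDiffAt (hU.mem_nhds hx)).mdifferentiableAt (by simp)).hasMFDerivAt

/-- Chain rule. Linearity over `ℝ` alone lets `T` be complex conjugation as well as a real scaling.
-/
theorem derivC_clm_comp (T : ℂ →L[ℝ] ℂ) {f : M → ℂ} {U : Set M} (hf : SmoothC f U)
    (hU : IsOpen U) {x : M} (hx : x ∈ U) (v : TangentSpace (𝓡 3) x) :
    derivC (fun y => T (f y)) x v = T (derivC f x v) := by
  have h := (T.hasMFDerivAt (x := f x)).comp x (hf.hasMFDerivAt hU hx)
  have h' : mfderiv (𝓡 3) 𝓘(ℝ, ℂ) (fun y => T (f y)) x = _ := h.mfderiv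
  unfold derivC
  rw [h']
  rfl

theorem derivVec_quatJ {f : M → Fin 2 → ℂ} {U : Set M} (hf : ∀ a, SmoothC (fun x => f x a) U)
    (hU : IsOpen U) {x : M} (hx : x ∈ U) (v : TangentSpace (𝓡 3) x) :
    derivVec (fun y => quatJ (f y)) x v = quatJ (derivVec f x v) := by
  ext a
  fin_cases a
  · exact derivC_clm_comp (-Complex.conjCLE.toContinuousLinearMap) (hf 1) hU hx v
  · exact derivC_clm_comp Complex.conjCLE.toContinuousLinearMap (hf 0) hU hx v

end

/-! ### Tuples of spinors paired with their images under `J` -/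

section

variable {M : Type*} [TopologicalSpace M] [ChartedSpace E3 M] [IsManifold (𝓡 3) ∞ M]
  {g : RMetric M} {o : MOrientation M} {S : SpinStructure g o}

/-- Summation over the tuple `(ψ₁, Jψ₁, …, ψₙ, Jψₙ)`. -/
theorem sum_withJ {A : Type*} [AddCommMonoid A] {n : ℕ} (ψ : Fin n → Spinor S)
    (F : Spinor S → A) : ∑ k, F (withJ ψ k) = ∑ l, (F (ψ l) + F (ψ l).J) := by
  classical
  -- The summand is extended by zero to all of `ℕ`, so that even and odd indices can be split
  -- without dependent bounds.
  have h := sum_fin_two_mul (n := n) (fun k => if hk : k < 2 * n then F (withJ ψ ⟨k, hk⟩) else 0)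
  have e1 : ∀ k : Fin (2 * n), F (withJ ψ k) =
      (fun k => if hk : k < 2 * n then F (withJ ψ ⟨k, hk⟩) else 0) (k : ℕ) := fun k => by simp
  rw [Finset.sum_congr rfl fun k _ => e1 k, h]
  refine Finset.sum_congr rfl fun l _ => ?_
  have h1 : 2 * (l : ℕ) < 2 * n := by omega
  have h2 : 2 * (l : ℕ) + 1 < 2 * n := by omega
  have e2 : (⟨2 * (l : ℕ) / 2, by omega⟩ : Fin n) = l := Fin.ext (by simp)
  have e3 : (⟨(2 * (l : ℕ) + 1) / 2, by omega⟩ : Fin n) = l := Fin.ext (by simp; omega)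
  simp only [h1, h2, dite_true, withJ, Nat.mul_mod_right, if_true, e2, e3]
  rw [if_neg (by omega)]

theorem mu_ofTuple_withJ {n : ℕ} (ψ : Fin n → Spinor S) (i j k x) :
    mu ((Twisted.ofTuple (withJ ψ)).rep i j k x) = 0 := by
  rw [mu_eq_sum]
  exact (sum_withJ ψ (fun χ => mu (Matrix.of fun a (_ : Fin 1) => χ.rep i x a))).trans
    (Finset.sum_eq_zero fun l _ => mu_col_add_mu_col_quatJ _)

theorem mu_pair_quatJ (v : Fin 2 → ℂ) :
    mu (Matrix.of fun a => ![v a, quatJ v a]) = 0 := by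
  rw [mu_eq_sum, Fin.sum_univ_two]
  exact mu_col_add_mu_col_quatJ v

/-! ### The Dirac operator -/

/-- The coefficients `¼ g(∇ eₐ, eᵦ)` are real, so the antilinearity of `J` does no harm. -/
theorem quatJ_conn_mulVec (i : S.ι) (k : Fin 3) (x : M) (v : Fin 2 → ℂ) :
    quatJ (S.conn i k x *ᵥ v) = S.conn i k x *ᵥ quatJ v := by
  simp only [SpinStructure.conn, Matrix.sum_mulVec, quatJ_sum, Matrix.smul_mulVec,
    quatJ_real_smul, ← Matrix.mulVec_mulVec, quatJ_gam_mulVec]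

/-- The Dirac operator commutes with the quaternionic structure. -/
theorem Spinor.dirac_J (ψ : Spinor S) {i : S.ι} {x : M} (hx : x ∈ S.U i) :
    ψ.J.dirac i x = quatJ (ψ.dirac i x) := by
  rw [Spinor.dirac, Spinor.dirac, quatJ_sum]
  refine Finset.sum_congr rfl fun k _ => ?_
  rw [quatJ_gam_mulVec, quatJ_add, quatJ_conn_mulVec,
    ← derivVec_quatJ (ψ.smooth i) (S.isOpen_U i) hx]
  rfl

theorem Spinor.IsHarmonic.J {ψ : Spinor S} (h : ψ.IsHarmonic) : ψ.J.IsHarmonic :=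
  fun i x hx => by rw [ψ.dirac_J hx, h i x hx, quatJ_zero]

theorem isHarmonic_withJ {n : ℕ} {ψ : Fin n → Spinor S} (h : ∀ l, (ψ l).IsHarmonic)
    (k : Fin (2 * n)) : (withJ ψ k).IsHarmonic := by
  unfold withJ
  split_ifs
  · exact h _
  · exact (h _).J

/-- For the product connections the twisted Dirac operator acts columnwise. -/
theorem dirac_ofTuple_apply {m : ℕ} (χ : Fin m → Spinor S) (i j k x) (a : Fin 2) (b : Fin m) :
    (Twisted.ofTuple χ).dirac (prodA M) (prodB M m) i j k x a b = (χ b).dirac i x a := by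
  simp only [Twisted.dirac, Spinor.dirac, Matrix.sum_apply, Finset.sum_apply]
  refine Finset.sum_congr rfl fun l _ => ?_
  have h : ∀ c, (Twisted.ofTuple χ).nabla (prodA M) (prodB M m) i j k l x c b =
      (derivVec ((χ b).rep i) x (S.frame i l x) + S.conn i l x *ᵥ (χ b).rep i x) c := by
    intro c
    simp only [Twisted.nabla, Connection.product, LinearMap.zero_apply, Matrix.zero_apply,
      zero_smul, add_zero, Matrix.mul_zero, sub_zero]
    rfl
  simp only [Matrix.mul_apply, Matrix.mulVec, dotProduct, h]

theorem diracEq_ofTuple {m : ℕ} {χ : Fin m → Spinor S} (h : ∀ k, (χ k).IsHarmonic) :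
    (Twisted.ofTuple χ).DiracEq (prodA M) (prodB M m) := by
  intro i j k x hx
  ext a b
  rw [dirac_ofTuple_apply, h b i x hx.1.1]
  rfl

theorem Twisted.DiracEq.smul {L : U1Bundle M} {m : ℕ} {E : SUBundle M m}
    {A : Connection L (uLie 1)} {B : Connection E (suLie m)} {Ψ : Twisted S L E}
    (h : Ψ.DiracEq A B) (c : ℝ) : (Ψ.smul c).DiracEq A B := by
  intro i j k x hx
  have hU : IsOpen (S.U i ∩ L.U j ∩ E.U k) :=
    ((S.isOpen_U i).inter (L.isOpen_U j)).inter (E.isOpen_U k)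
  have hn : ∀ l, (Ψ.smul c).nabla A B i j k l x = (c : ℂ) • Ψ.nabla A B i j k l x := by
    intro l
    have hd : derivMat ((Ψ.smul c).rep i j k) x (S.frame i l x) =
        (c : ℂ) • derivMat (Ψ.rep i j k) x (S.frame i l x) := by
      ext a b
      have := derivC_clm_comp (c • ContinuousLinearMap.id ℝ ℂ) (Ψ.smooth i j k a b) hU hx
        (S.frame i l x)
      simpa [derivMat, Twisted.smul] using this
    rw [Twisted.nabla, hd, Twisted.nabla]
    simp only [Twisted.smul, smul_add, smul_sub, Matrix.mul_smul, Matrix.smul_mul]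
    rw [smul_comm]
  have h0 := h i j k x hx
  simp only [Twisted.dirac] at h0 ⊢
  simp only [hn, Matrix.mul_smul, ← Finset.smul_sum, h0, smul_zero]

theorem curvatureEq_zero_smul {n : ℕ} (ψ : Fin n → Spinor S) (c : ℝ) :
    ((Twisted.ofTuple (withJ ψ)).smul c).CurvatureEq (prodA M) 0 := by
  intro i j k x _
  have : ((Twisted.ofTuple (withJ ψ)).smul c).rep i j k x =
    (c : ℂ) • (Twisted.ofTuple (withJ ψ)).rep i j k x := rfl
  rw [this, mu_smul, mu_ofTuple_withJ]
  simp

theorem curvatureEq_zero {n : ℕ} (ψ : Fin n → Spinor S) :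
    (Twisted.ofTuple (withJ ψ)).CurvatureEq (prodA M) 0 := by
  intro i j k x _
  rw [mu_ofTuple_withJ]
  simp

/-! ### Norms -/

theorem Twisted.normSq_smul {L : U1Bundle M} {m : ℕ} {E : SUBundle M m} (Ψ : Twisted S L E)
    (c : ℝ) (x : M) : (Ψ.smul c).normSq x = c ^ 2 * Ψ.normSq x := by
  simp only [Twisted.normSq, Twisted.smul, Finset.mul_sum, Matrix.smul_apply, smul_eq_mul,
    norm_mul, mul_pow, Complex.norm_real, Real.norm_eq_abs, sq_abs]

theorem Spinor.normSq_J (ψ : Spinor S) (x : M) : ψ.J.normSq x = ψ.normSq x := by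
  simp [Spinor.normSq, Spinor.J, quatJ, Fin.sum_univ_two, add_comm]

theorem normSq_ofTuple {m : ℕ} (χ : Fin m → Spinor S) (x : M) :
    (Twisted.ofTuple χ).normSq x = ∑ k, (χ k).normSq x := by
  simp only [Twisted.normSq, Spinor.normSq]
  rw [Finset.sum_comm]
  rfl

/-- The factor `2`, due to `|Jψ| = |ψ|`, is the origin of the `1/2` in the normalisation. -/
theorem normSq_ofTuple_withJ {n : ℕ} (ψ : Fin n → Spinor S) (x : M) :
    (Twisted.ofTuple (withJ ψ)).normSq x = 2 * ∑ l, (ψ l).normSq x := by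
  rw [normSq_ofTuple, sum_withJ ψ (fun χ => χ.normSq x), Finset.mul_sum]
  simp only [Spinor.normSq_J, two_mul]

theorem Spinor.normSq_nonneg (ψ : Spinor S) (x : M) : 0 ≤ ψ.normSq x := by
  unfold Spinor.normSq
  positivity

/-- The norm may be computed in any trivialisation. -/
theorem Spinor.normSq_eq (ψ : Spinor S) {i : S.ι} {x : M} (hx : x ∈ S.U i) :
    ψ.normSq x = ∑ a, ‖ψ.rep i x a‖ ^ 2 := by
  have hmem := S.mem_U_at x
  -- Written as a Hermitian product, the norm is visibly invariant under the unitary transition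
  -- matrix.
  have key : ∀ v : Fin 2 → ℂ, ((∑ a, ‖v a‖ ^ 2 : ℝ) : ℂ) = star v ⬝ᵥ v := by
    intro v
    push_cast
    simp only [dotProduct, Pi.star_apply]
    refine Finset.sum_congr rfl fun a _ => ?_
    exact (Complex.conj_mul' (v a)).symm
  have hu : (S.trans (S.indexAt x) i x)ᴴ * S.trans (S.indexAt x) i x = 1 :=
    Matrix.mem_unitaryGroup_iff'.1
      (Matrix.mem_specialUnitaryGroup_iff.1 (S.trans_mem _ _ x ⟨hmem, hx⟩)).1
  apply Complex.ofReal_injective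
  rw [Spinor.normSq, key, key, ψ.compat _ i x ⟨hmem, hx⟩, Matrix.star_mulVec,
    ← Matrix.dotProduct_mulVec, Matrix.mulVec_mulVec, hu, Matrix.one_mulVec]

/-- The chosen index `S.indexAt y` may jump with `y`; near `x` the norm is computed instead in the
fixed trivialisation at `x`. -/
theorem Spinor.continuous_normSq (ψ : Spinor S) : Continuous ψ.normSq := by
  rw [continuous_iff_continuousAt]
  intro x
  have hU := (S.isOpen_U (S.indexAt x)).mem_nhds (S.mem_U_at x)
  have h : ContinuousAt (fun y => ∑ a, ‖ψ.rep (S.indexAt x) y a‖ ^ 2) x :=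
    tendsto_finsetSum _ fun a _ =>
      (((ψ.smooth (S.indexAt x) a).continuousOn.continuousAt hU).norm.pow 2)
  refine h.congr ?_
  filter_upwards [hU] with y hy
  exact (ψ.normSq_eq hy).symm

variable [T2Space M] [SigmaCompactSpace M] [MeasurableSpace M]

theorem l2norm_eq_one_iff {L : U1Bundle M} {m : ℕ} {E : SUBundle M m} (Ψ : Twisted S L E) :
    Ψ.l2norm = 1 ↔ ∫⁻ x, ENNReal.ofReal (Ψ.normSq x) ∂(riemVolume g) = 1 := by
  rw [Twisted.l2norm]
  constructor
  · intro h
    rw [← rpow_half_sq (∫⁻ x, ENNReal.ofReal (Ψ.normSq x) ∂(riemVolume g)), h, one_pow]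
  · intro h
    rw [h, ENNReal.one_rpow]

theorem lintegral_normSq_smul {L : U1Bundle M} {m : ℕ} {E : SUBundle M m} (Ψ : Twisted S L E)
    (c : ℝ) : ∫⁻ x, ENNReal.ofReal ((Ψ.smul c).normSq x) ∂(riemVolume g) =
      ENNReal.ofReal (c ^ 2) * ∫⁻ x, ENNReal.ofReal (Ψ.normSq x) ∂(riemVolume g) := by
  rw [← lintegral_const_mul' _ _ ENNReal.ofReal_ne_top]
  refine lintegral_congr fun x => ?_
  rw [Twisted.normSq_smul, ENNReal.ofReal_mul (sq_nonneg c)]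

theorem Spinor.l2norm_sq (φ : Spinor S) :
    φ.l2norm ^ 2 = ∫⁻ x, ENNReal.ofReal (φ.normSq x) ∂(riemVolume g) :=
  rpow_half_sq _

end

/-! ### The Riemannian volume -/

section

variable {M : Type*} [TopologicalSpace M] [ChartedSpace E3 M] [IsManifold (𝓡 3) ∞ M]

theorem linearIndependent_coordVec (c : M) {u : E3} (hu : u ∈ (chartAt E3 c).target) :
    LinearIndependent ℝ (coordVec c u) := by
  have h : Function.Injective (mfderiv (𝓡 3) (𝓡 3) (chartAt E3 c).symm u) :=
    (mdifferentiable_chart (I := 𝓡 3) c).symm.mfderiv_injective hu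
  have hb : LinearIndependent ℝ fun i : Fin 3 => (EuclideanSpace.single i (1 : ℝ) : E3) := by
    have h := (EuclideanSpace.basisFun (Fin 3) ℝ).toBasis.linearIndependent
    have e : ⇑(EuclideanSpace.basisFun (Fin 3) ℝ).toBasis =
        fun i : Fin 3 => (EuclideanSpace.single i (1 : ℝ) : E3) := by
      ext1 i
      simp
    rw [e] at h
    exact h
  let T : E3 →L[ℝ] TangentSpace (𝓡 3) ((chartAt E3 c).symm u) :=
    mfderiv (𝓡 3) (𝓡 3) (chartAt E3 c).symm u
  exact hb.map' T.toLinearMap (LinearMap.ker_eq_bot.2 h)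

/-- A Gram matrix of independent vectors is positive definite: its quadratic form at `y` is the
squared length of `∑ yᵢ vᵢ`. -/
theorem det_gram_pos (g : RMetric M) {x : M} {v : Fin 3 → TangentSpace (𝓡 3) x}
    (hv : LinearIndependent ℝ v) :
    0 < Matrix.det (Matrix.of fun i j : Fin 3 => g.inner x (v i) (v j)) := by
  apply Matrix.PosDef.det_pos
  refine Matrix.PosDef.of_dotProduct_mulVec_pos ?_ fun y hy => ?_
  · ext i j
    simpa using g.symm x _ _
  · have h0 : ∑ i, y i • v i ≠ 0 := fun h =>
      hy (funext fun i => Fintype.linearIndependent_iff.1 hv y h i)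
    have h := g.pos x _ h0
    have e : g.inner x (∑ i, y i • v i) (∑ i, y i • v i) =
        star y ⬝ᵥ ((Matrix.of fun i j : Fin 3 => g.inner x (v i) (v j)) *ᵥ y) := by
      simp only [map_sum, map_smul, sum_apply, smul_apply,
        dotProduct, Matrix.mulVec, Matrix.of_apply, smul_eq_mul, star_trivial, Finset.mul_sum]
      rw [Finset.sum_comm]
      exact Finset.sum_congr rfl fun i _ => Finset.sum_congr rfl fun j _ => by ring
    rwa [e] at h

theorem volDensity_pos (g : RMetric M) (c : M) {u : E3} (hu : u ∈ (chartAt E3 c).target) :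
    0 < volDensity g c u :=
  Real.sqrt_pos.2 (det_gram_pos g (linearIndependent_coordVec c hu))

/-- The coordinate field is the image of a constant section under the tangent map of the inverse
chart. Order `0` suffices, as only continuity of the density is needed. -/
theorem contMDiffOn_coordVec (c : M) (i : Fin 3) :
    ContMDiffOn (𝓡 3) ((𝓡 3).prod 𝓘(ℝ, E3)) 0
      (fun u => (⟨(chartAt E3 c).symm u, coordVec c u i⟩ : TangentBundle (𝓡 3) M))
      (chartAt E3 c).target := by
  have ho : IsOpen (chartAt E3 c).target := (chartAt E3 c).open_target
  have h := (contMDiffOn_chart_symm (I := 𝓡 3) (n := ∞) (x := c)).contMDiffOn_tangentMapWithin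
    (m := 0) (by simp) ho.uniqueMDiffOn
  have hs : ContMDiff (𝓡 3) ((𝓡 3).prod 𝓘(ℝ, E3)) 0
      (fun u : E3 => (⟨u, EuclideanSpace.single i (1 : ℝ)⟩ : TangentBundle (𝓡 3) E3)) := by
    exact contMDiff_vectorSpace_iff_contDiff.2 contDiff_const
  refine (h.comp hs.contMDiffOn (fun u hu => hu)).congr fun u hu => ?_
  simp only [Function.comp_apply, tangentMapWithin, coordVec]
  rw [mfderivWithin_of_isOpen ho hu]

theorem continuousOn_inner_coordVec (g : RMetric M) (c : M) (i j : Fin 3) :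
    ContinuousOn (fun u => g.inner ((chartAt E3 c).symm u) (coordVec c u i) (coordVec c u j))
      (chartAt E3 c).target := by
  have hg : ContMDiffOn (𝓡 3) ((𝓡 3).prod 𝓘(ℝ, E3 →L[ℝ] E3 →L[ℝ] ℝ)) 0
      (fun u : E3 => Bundle.TotalSpace.mk' (E3 →L[ℝ] E3 →L[ℝ] ℝ)
        (E := fun x : M => TangentSpace (𝓡 3) x →L[ℝ] TangentSpace (𝓡 3) x →L[ℝ] ℝ)
        ((chartAt E3 c).symm u) (g.inner ((chartAt E3 c).symm u))) (chartAt E3 c).target :=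
    (g.contMDiff.of_le (by simp)).comp_contMDiffOn
      (contMDiffOn_chart_symm (I := 𝓡 3) (n := 0) (x := c))
  have h := ContMDiffOn.clm_bundle_apply₂ (F₁ := E3) (F₂ := E3) (F₃ := ℝ)
    (E₃ := fun _ : M => ℝ) hg (contMDiffOn_coordVec c i) (contMDiffOn_coordVec c j)
  -- A section of the trivial line bundle is continuous only if its fibre component is.
  intro u hu
  have h1 := h u hu
  simp only [Bundle.contMDiffWithinAt_totalSpace] at h1
  exact h1.2.continuousWithinAt

theorem continuousOn_volDensity (g : RMetric M) (c : M) :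
    ContinuousOn (volDensity g c) (chartAt E3 c).target := by
  rw [continuousOn_iff_continuous_domRestrict]
  refine Real.continuous_sqrt.comp (Continuous.matrix_det (continuous_matrix fun i j => ?_))
  exact (continuousOn_iff_continuous_domRestrict.1 (continuousOn_inner_coordVec g c i j))

variable [T2Space M] [SigmaCompactSpace M] [MeasurableSpace M] [BorelSpace M]

/-- The integral of a function against the Riemannian volume, in charts. -/
theorem lintegral_riemVolume (g : RMetric M) {F : M → ℝ≥0∞} (hF : Measurable F) :
    ∫⁻ x, F x ∂(riemVolume g) = ∑' c : M, ∫⁻ u in (chartAt E3 c).target,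
      ENNReal.ofReal (volDensity g c u) *
        (ENNReal.ofReal (chartPartition M c ((chartAt E3 c).symm u)) *
          F ((chartAt E3 c).symm u)) := by
  rw [riemVolume, lintegral_sum_measure]
  refine tsum_congr fun c => ?_
  have hρ : Measurable fun x => ENNReal.ofReal (chartPartition M c x) :=
    ((chartPartition M c).contMDiff.continuous.measurable).ennreal_ofReal
  -- The inverse chart and the density are controlled only on the chart target, hence a.e.
  -- measurability for the restricted measure.
  have hs : AEMeasurable (chartAt E3 c).symm (volume.restrict (chartAt E3 c).target) :=
    (chartAt E3 c).continuousOn_symm.aemeasurable (chartAt E3 c).open_target.measurableSet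
  have hd : AEMeasurable (fun u => ENNReal.ofReal (volDensity g c u))
      (volume.restrict (chartAt E3 c).target) :=
    ((continuousOn_volDensity g c).aemeasurable
      (chartAt E3 c).open_target.measurableSet).ennreal_ofReal
  rw [lintegral_withDensity_eq_lintegral_mul _ hρ hF, chartVolume,
    lintegral_map' (hρ.mul hF).aemeasurable (hs.mono_ac (withDensity_absolutelyContinuous _ _))]
  exact lintegral_withDensity_eq_lintegral_mul₀ hd ((hρ.mul hF).comp_aemeasurable hs)

/-- By compactness only finitely many functions of the partition are nonzero, and each contributes
at most the integral of a continuous density over the compact chart image of its support. -/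
theorem isFiniteMeasure_riemVolume [CompactSpace M] (g : RMetric M) :
    IsFiniteMeasure (riemVolume g) := by
  refine ⟨?_⟩
  rw [← lintegral_one, lintegral_riemVolume g measurable_const]
  have hfin := (chartPartition M).locallyFinite.finite_nonempty_of_compact
  rw [tsum_eq_sum (s := hfin.toFinset)]
  · refine ENNReal.sum_lt_top.2 fun c _ => ?_
    set φ := chartAt E3 c
    have hsub : tsupport (chartPartition M c) ⊆ φ.source :=
      (SmoothPartitionOfUnity.exists_isSubordinate_chartAt_source (𝓡 3) M).choose_spec c
    have hK : IsCompact (φ '' tsupport (chartPartition M c)) :=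
      (isClosed_tsupport _).isCompact.image_of_continuousOn (φ.continuousOn.mono hsub)
    have hKt : φ '' tsupport (chartPartition M c) ⊆ φ.target := by
      rintro _ ⟨x, hx, rfl⟩
      exact φ.map_source (hsub hx)
    have hint : IntegrableOn (volDensity g c) (φ '' tsupport (chartPartition M c)) :=
      ((continuousOn_volDensity g c).mono hKt).integrableOn_compact hK
    refine lt_of_le_of_lt ?_ hint.lintegral_lt_top
    rw [← lintegral_indicator φ.open_target.measurableSet,
      ← lintegral_indicator hK.measurableSet]
    refine lintegral_mono fun u => ?_
    by_cases hu : u ∈ φ.target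
    · rw [Set.indicator_of_mem hu]
      by_cases hρ : chartPartition M c (φ.symm u) = 0
      · simp [hρ]
      -- Where the partition function is nonzero, the point lies in the compact image, and the
      -- function is at most `1`.
      · have huK : u ∈ φ '' tsupport (chartPartition M c) :=
          ⟨φ.symm u, subset_tsupport _ hρ, φ.right_inv hu⟩
        rw [Set.indicator_of_mem huK, mul_one]
        refine mul_le_of_le_one_right' ?_
        exact ENNReal.ofReal_le_one.2 ((chartPartition M).le_one c _)
    · rw [Set.indicator_of_notMem hu]
      exact zero_le
  · intro c hc
    have h0 : ∀ x, chartPartition M c x = 0 := by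
      intro x
      by_contra hx
      exact hc (hfin.mem_toFinset.2 ⟨x, hx⟩)
    simp [h0]

/-- Some partition function is positive at `x`. In its chart the integrand is positive on a nonempty
open set, which has positive Lebesgue measure. -/
theorem lintegral_riemVolume_ne_zero (g : RMetric M) {f : M → ℝ} (hf : Continuous f)
    (h0 : ∀ x, 0 ≤ f x) {x : M} (hx : f x ≠ 0) :
    ∫⁻ y, ENNReal.ofReal (f y) ∂(riemVolume g) ≠ 0 := by
  rw [lintegral_riemVolume g hf.measurable.ennreal_ofReal, Ne, ENNReal.tsum_eq_zero, not_forall]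
  obtain ⟨c, hc⟩ := (chartPartition M).exists_pos_of_mem (Set.mem_univ x)
  have hsub : tsupport (chartPartition M c) ⊆ (chartAt E3 c).source :=
    (SmoothPartitionOfUnity.exists_isSubordinate_chartAt_source (𝓡 3) M).choose_spec c
  have hxs : x ∈ (chartAt E3 c).source := hsub (subset_tsupport _ hc.ne')
  refine ⟨c, ?_⟩
  set φ := chartAt E3 c
  have hcont : ContinuousOn (fun u => chartPartition M c (φ.symm u) * f (φ.symm u)) φ.target :=
    ((chartPartition M c).contMDiff.continuous.mul hf).comp_continuousOn φ.continuousOn_symm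
  have hVo := hcont.isOpen_inter_preimage φ.open_target isOpen_Ioi (t := Set.Ioi 0)
  have hVne : (φ.target ∩ (fun u => chartPartition M c (φ.symm u) * f (φ.symm u)) ⁻¹'
      Set.Ioi 0).Nonempty :=
    ⟨φ x, φ.map_source hxs, by
      simpa [φ.left_inv hxs] using mul_pos hc ((h0 x).lt_of_ne' hx)⟩
  intro hz
  -- If the chart integral were zero, the integrand would vanish almost everywhere, making that open
  -- set null.
  have hae := (lintegral_eq_zero_iff' ?_).1 hz
  · rw [Filter.EventuallyEq, ae_restrict_iff' φ.open_target.measurableSet] at hae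
    refine hVo.measure_ne_zero volume hVne (measure_mono_null ?_ hae)
    rintro u ⟨hu, hpos⟩ hu0
    have hpos' : 0 < chartPartition M c (φ.symm u) * f (φ.symm u) := hpos
    have h1 := (ENNReal.ofReal_pos.2 (mul_pos (volDensity_pos g c hu) hpos')).ne'
    rw [ENNReal.ofReal_mul (volDensity_pos g c hu).le,
      ENNReal.ofReal_mul ((chartPartition M).nonneg c _)] at h1
    exact h1 (hu0 hu)
  · have hm : ContinuousOn (fun u => volDensity g c u) φ.target := continuousOn_volDensity g c
    have hρ : ContinuousOn (fun u => chartPartition M c (φ.symm u)) φ.target :=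
      (chartPartition M c).contMDiff.continuous.comp_continuousOn φ.continuousOn_symm
    have hf' : ContinuousOn (fun u => f (φ.symm u)) φ.target :=
      hf.comp_continuousOn φ.continuousOn_symm
    have ht := φ.open_target.measurableSet
    exact (hm.aemeasurable ht).ennreal_ofReal.mul
      ((hρ.aemeasurable ht).ennreal_ofReal.mul (hf'.aemeasurable ht).ennreal_ofReal)

/-! ### `L²` norms of the tuple -/

variable {g : RMetric M} {o : MOrientation M} {S : SpinStructure g o}

theorem lintegral_normSq_ofTuple_withJ {n : ℕ} (ψ : Fin n → Spinor S) :
    ∫⁻ x, ENNReal.ofReal ((Twisted.ofTuple (withJ ψ)).normSq x) ∂(riemVolume g) =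
      2 * ∑ l, (ψ l).l2norm ^ 2 := by
  simp only [Spinor.l2norm, rpow_half_sq, normSq_ofTuple_withJ]
  rw [← lintegral_finsetSum' _ fun l _ =>
      (ψ l).continuous_normSq.measurable.ennreal_ofReal.aemeasurable,
    ← lintegral_const_mul' _ _ ENNReal.ofNat_ne_top]
  refine lintegral_congr fun x => ?_
  rw [ENNReal.ofReal_mul zero_le_two, ENNReal.ofReal_sum_of_nonneg fun l _ => (ψ l).normSq_nonneg x,
    ENNReal.ofReal_ofNat]

theorem Spinor.l2norm_sq_ne_top [CompactSpace M] (φ : Spinor S) : φ.l2norm ^ 2 ≠ ⊤ := by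
  have := isFiniteMeasure_riemVolume g
  obtain ⟨C, hC⟩ := (isCompact_range φ.continuous_normSq).bddAbove
  rw [φ.l2norm_sq]
  refine ne_top_of_le_ne_top ?_
    (lintegral_mono fun x => ENNReal.ofReal_le_ofReal (hC (Set.mem_range_self x)))
  rw [lintegral_const]
  exact ENNReal.mul_ne_top ENNReal.ofReal_ne_top (measure_ne_top _ _)

end

end MultiSW

theorem mainTheorem10 {M : Type*} [TopologicalSpace M] [ChartedSpace MultiSW.E3 M]
    [IsManifold (𝓡 3) ∞ M] [T2Space M] [CompactSpace M] [MeasurableSpace M] [BorelSpace M]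
    (g : MultiSW.RMetric M) (o : MultiSW.MOrientation M) (S : MultiSW.SpinStructure g o)
    {n : ℕ} (ψ : Fin n → MultiSW.Spinor S) (hψ : ∀ l, (ψ l).IsHarmonic) :
    (MultiSW.Twisted.ofTuple (MultiSW.withJ ψ)).DiracEq (MultiSW.prodA M)
        (MultiSW.prodB M (2 * n)) ∧
    (MultiSW.Twisted.ofTuple (MultiSW.withJ ψ)).CurvatureEq (MultiSW.prodA M) 0 ∧
    (∀ φ : MultiSW.Spinor S, ∀ i, ∀ x ∈ S.U i,
      MultiSW.mu (Matrix.of fun a => ![φ.rep i x a, φ.J.rep i x a]) = 0) ∧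
    (MultiSW.IsSWSolution (MultiSW.prodB M (2 * n))
        (MultiSW.Twisted.ofTuple (MultiSW.withJ ψ)) (MultiSW.prodA M) 0 ↔
      ∑ l, (ψ l).l2norm ^ 2 = 1 / 2) ∧
    ((∃ l x, (ψ l).normSq x ≠ 0) → ∃! c : ℝ, 0 < c ∧
      MultiSW.IsSWSolution (MultiSW.prodB M (2 * n))
        ((MultiSW.Twisted.ofTuple (MultiSW.withJ ψ)).smul c) (MultiSW.prodA M) 0) := by
  have hD := MultiSW.diracEq_ofTuple (MultiSW.isHarmonic_withJ hψ)
  have hC := MultiSW.curvatureEq_zero ψ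
  refine ⟨hD, hC, fun φ i x _ => MultiSW.mu_pair_quatJ _, ?_, ?_⟩
  -- The Dirac and curvature equations already hold, so being a solution reduces to the
  -- normalisation.
  · have h : MultiSW.IsSWSolution (MultiSW.prodB M (2 * n))
        (MultiSW.Twisted.ofTuple (MultiSW.withJ ψ)) (MultiSW.prodA M) 0 ↔
        (MultiSW.Twisted.ofTuple (MultiSW.withJ ψ)).l2norm = 1 :=
      ⟨fun h => h.norm_eq, fun h => ⟨h, hD, hC⟩⟩
    rw [h, MultiSW.l2norm_eq_one_iff, MultiSW.lintegral_normSq_ofTuple_withJ, mul_comm,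
      ENNReal.eq_div_iff two_ne_zero ENNReal.ofNat_ne_top, mul_comm]
  · rintro ⟨l, x, hx⟩
    have h : ∀ c : ℝ, MultiSW.IsSWSolution (MultiSW.prodB M (2 * n))
        ((MultiSW.Twisted.ofTuple (MultiSW.withJ ψ)).smul c) (MultiSW.prodA M) 0 ↔
        ENNReal.ofReal (c ^ 2) * (2 * ∑ l, (ψ l).l2norm ^ 2) = 1 := by
      intro c
      rw [← MultiSW.lintegral_normSq_ofTuple_withJ, ← MultiSW.lintegral_normSq_smul,
        ← MultiSW.l2norm_eq_one_iff]
      exact ⟨fun h => h.norm_eq, fun h => ⟨h, hD.smul c, MultiSW.curvatureEq_zero_smul ψ c⟩⟩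
    simp only [h]
    -- If the sum vanished, so would its `l`-th term, although `ψ l` is nonzero at `x`.
    refine MultiSW.existsUnique_pos_sq_mul_eq_one (mul_ne_zero two_ne_zero fun h0 => ?_)
      (ENNReal.mul_ne_top ENNReal.ofNat_ne_top
        (ENNReal.sum_ne_top.2 fun l _ => (ψ l).l2norm_sq_ne_top))
    refine MultiSW.lintegral_riemVolume_ne_zero g (ψ l).continuous_normSq (ψ l).normSq_nonneg hx ?_
    rw [← (ψ l).l2norm_sq]
    exact Finset.sum_eq_zero_iff.1 h0 l (Finset.mem_univ l)
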